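/- Let $f:\mathbb R^n\to\mathbb R^n$ be locally Lipschitz and let $\phi(t,x)$ denote the solution of $\dot x=f(x)$ with $\phi(0,x)=x$ on its maximal interval of existence. For a set $\mathcal A\subset\mathbb R^n$ write $\|x\|_{\mathcal A}=\inf_{y\in\mathcal A}\|x-y\|$. Let $\mathcal A\subset\mathbb R^n$ be a nonempty compact set that is uniformly asymptotically stable, i.e. (i) for every $\varepsilon>0$ there is $\delta>0$ such that $\|x_0\|_{\mathcal A}<\delta$ implies that $\phi(t,x_0)$ exists and $\|\phi(t,x_0)\|_{\mathcal A}<\varepsilon$ for all $t\ge 0$; and (ii) there is $\rho>0$ such that for every $\varepsilon>0$ there is $T>0$ such that, whenever $\|x_0\|_{\mathcal A}<\rho$, the solution $\phi(t,x_0)$ exists for all $t\ge0$ and $\|\phi(t,x_0)\|_{\mathcal A}<\varepsilon$ for all $t\ge T$. Let $\mathcal D(\mathcal A)$ be the domain of attraction: the set of all $x$ for which $\phi(t,x)$ exists for all $t\ge 0$ and $\lim_{t\to\infty}\|\phi(t,x)\|_{\mathcal A}=0$. Let $\omega:\mathbb R^n\to\mathbb R$ be continuous and positive definite with respect to $\mathcal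 A$ (that is, $\omega=0$ on $\mathcal A$ and $\omega>0$ on $\mathbb R^n\setminus\mathcal A$), and define $V:\mathbb R^n\to[0,\infty]$ by $$V(x)=\int_0^\infty \omega(\phi(t,x))\,dt,$$ where $V(x)=\infty$ if the integral diverges or if $\phi(t,x)$ does not exist for all $t\ge 0$. Assume: (a) for every $\delta>0$ there is $c>0$ such that $\omega(x)>c$ whenever $\|x\|_{\mathcal A}>\delta$; (b) there is $\rho>0$ such that $V(x)<\infty$ whenever $\|x\|_{\mathcal A}<\rho$; (c) for every $\varepsilon>0$ there is $\delta>0$ such that $\|x\|_{\mathcal A}<\delta$ implies $V(x)<\varepsilon$. Then: 1. $V(x)<\infty$ if and only if $x\in\mathcal D(\mathcal A)$. 2. $V(x)\to\infty$ as $x\to\partial\mathcal D(\mathcal A)$, provided that $\mathcal D(\mathcal A)$ is bounded. More generally, without boundedness, $V(x)\to\infty$ as $x\to y$ for every $y\in\partial\mathcal D(\mathcal A)$ whose solution $\phi(t,y)$ exists for all $t\ge 0$. 3. $V$ is positive definite with respect to $\mathcal A$: $V=0$ on $\mathcal A$ and $V>0$ on $\mathbb R^n\setminus\mathcal A$. 4.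 $V$ is continuous on $\mathcal D(\mathcal A)$, and for every $x\in\mathcal D(\mathcal A)$ the derivative along solutions $\dot V(x)=\lim_{t\to0+}\frac{V(\phi(t,x))-V(x)}{t}$ is well defined and $\dot V(x)=-\omega(x)$. -/

import Mathlib

open Set Filter Topology MeasureTheory
open scoped ENNReal

noncomputable section

namespace ZubovLyapunov

variable {n : ℕ}

/-- The maximal interval of existence of the solution of `x' = f x`, `x 0 = x₀`:
the times `t` (of either sign) such that a solution exists on the closed interval between
`0` and `t`. -/
def maxInterval (f : EuclideanSpace ℝ (Fin n) → EuclideanSpace ℝ (Fin n))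
    (x₀ : EuclideanSpace ℝ (Fin n)) : Set ℝ :=
  {t | ∃ γ : ℝ → EuclideanSpace ℝ (Fin n),
    γ 0 = x₀ ∧ IsIntegralCurveOn γ (fun _ => f) (uIcc 0 t)}

open Classical in
/-- The solution `φ(t, x₀)` of `x' = f x`, `x 0 = x₀` at a time `t` of its maximal interval of
existence. For locally Lipschitz `f` the value does not depend on the choice of the solution.
(Outside the maximal interval it has the meaningless value `0`.) -/
def flow (f : EuclideanSpace ℝ (Fin n) → EuclideanSpace ℝ (Fin n)) (t : ℝ)
    (x₀ : EuclideanSpace ℝ (Fin n)) : EuclideanSpace ℝ (Fin n) :=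
  if h : t ∈ maxInterval f x₀ then Classical.choose h t else 0

/-- The solution starting at `x₀` exists for all `t ≥ 0`. -/
def ForwardComplete (f : EuclideanSpace ℝ (Fin n) → EuclideanSpace ℝ (Fin n))
    (x₀ : EuclideanSpace ℝ (Fin n)) : Prop :=
  Ici 0 ⊆ maxInterval f x₀

/-- Uniform asymptotic stability of a set `A` for `x' = f x`. -/
structure IsUAS (f : EuclideanSpace ℝ (Fin n) → EuclideanSpace ℝ (Fin n))
    (A : Set (EuclideanSpace ℝ (Fin n))) : Prop where
  stable : ∀ ε : ℝ, 0 < ε → ∃ δ : ℝ, 0 < δ ∧ ∀ x₀, Metric.infDist x₀ A < δ →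
    ForwardComplete f x₀ ∧ ∀ t : ℝ, 0 ≤ t → Metric.infDist (flow f t x₀) A < ε
  attractive : ∃ ρ : ℝ, 0 < ρ ∧ ∀ ε : ℝ, 0 < ε → ∃ T : ℝ, 0 < T ∧
    ∀ x₀, Metric.infDist x₀ A < ρ →
      ForwardComplete f x₀ ∧ ∀ t : ℝ, T ≤ t → Metric.infDist (flow f t x₀) A < ε

/-- The domain of attraction of `A`. -/
def domainOfAttraction (f : EuclideanSpace ℝ (Fin n) → EuclideanSpace ℝ (Fin n))
    (A : Set (EuclideanSpace ℝ (Fin n))) : Set (EuclideanSpace ℝ (Fin n)) :=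
  {x | ForwardComplete f x ∧ Tendsto (fun t => Metric.infDist (flow f t x) A) atTop (𝓝 0)}

/-- `g` is positive definite on `D` with respect to `A`. -/
def IsPosDefOn {β : Type*} [Zero β] [LT β] (g : EuclideanSpace ℝ (Fin n) → β)
    (D A : Set (EuclideanSpace ℝ (Fin n))) : Prop :=
  (∀ x ∈ A, g x = 0) ∧ ∀ x ∈ D \ A, 0 < g x

open Classical in
/-- `V(x) = ∫₀^∞ ω(φ(t,x)) dt` for a nonnegative function `ω`, with `V(x) = ∞` if the integral
diverges or the solution from `x` does not exist for all `t ≥ 0`. -/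
def V (f : EuclideanSpace ℝ (Fin n) → EuclideanSpace ℝ (Fin n))
    (ω : EuclideanSpace ℝ (Fin n) → ℝ) (x : EuclideanSpace ℝ (Fin n)) : ℝ≥0∞ :=
  if ForwardComplete f x then ∫⁻ t in Ici (0 : ℝ), ENNReal.ofReal (ω (flow f t x)) else ⊤

/-- The assumption made on `ω` and on the resulting function `V`. -/
structure OmegaAssumption (f : EuclideanSpace ℝ (Fin n) → EuclideanSpace ℝ (Fin n))
    (ω : EuclideanSpace ℝ (Fin n) → ℝ) (A : Set (EuclideanSpace ℝ (Fin n))) : Prop where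
  lower : ∀ δ : ℝ, 0 < δ → ∃ c : ℝ, 0 < c ∧ ∀ x, δ < Metric.infDist x A → c < ω x
  finite : ∃ ρ : ℝ, 0 < ρ ∧ ∀ x, Metric.infDist x A < ρ → V f ω x < ⊤
  small : ∀ ε : ℝ, 0 < ε → ∃ δ : ℝ, 0 < δ ∧
    ∀ x, Metric.infDist x A < δ → V f ω x < ENNReal.ofReal ε

/-- The derivative of `U` at `x` along solutions of `x' = f x`,
`lim_{t → 0+} (U(φ(t,x)) - U(x)) / t`, is well defined (the solution exists and `U` is finite along
it for small `t ≥ 0`) and equals `d`. -/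
def HasDerivAlong (f : EuclideanSpace ℝ (Fin n) → EuclideanSpace ℝ (Fin n))
    (U : EuclideanSpace ℝ (Fin n) → ℝ≥0∞) (x : EuclideanSpace ℝ (Fin n)) (d : ℝ) : Prop :=
  U x < ⊤ ∧ (∀ᶠ t in 𝓝[>] (0 : ℝ), t ∈ maxInterval f x ∧ U (flow f t x) < ⊤) ∧
    Tendsto (fun t : ℝ => ((U (flow f t x)).toReal - (U x).toReal) / t) (𝓝[>] 0) (𝓝 d)

end ZubovLyapunov

end

noncomputable section

namespace ZubovLyapunov

open scoped NNReal

variable {n : ℕ} {f g : EuclideanSpace ℝ (Fin n) → EuclideanSpace ℝ (Fin n)}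
  {ω : EuclideanSpace ℝ (Fin n) → ℝ} {A : Set (EuclideanSpace ℝ (Fin n))}
  {x y : EuclideanSpace ℝ (Fin n)} {γ η : ℝ → EuclideanSpace ℝ (Fin n)} {s t T : ℝ}

/-! Everything rests on `V_split`: V(x) = ∫₀^T ω(φ(t,x)) dt + V(φ(T,x)). The head is finite and
depends continuously on x; the tail is controlled once φ(T,x) is close to `A`. If V(x) is finite,
the orbit cannot stay away from `A`, where ω is bounded below, and stability then traps it near `A`.
Conversely, an attracted orbit reaches the region where V is finite. The same argument makes the
domain of attraction open, so V = ∞ on its boundary. As a supremum of heads, V is lower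
semicontinuous at forward complete points (`eventually_lt_V`), which gives the blow-up at the
boundary; a small tail gives upper semicontinuity inside. The derivative is the fundamental theorem
of calculus applied to the head. -/

/-- `γ` solves `x' = f x` on `[0, T]` with initial value `x`. -/
def IsSolutionUpTo (f : EuclideanSpace ℝ (Fin n) → EuclideanSpace ℝ (Fin n))
    (x : EuclideanSpace ℝ (Fin n)) (γ : ℝ → EuclideanSpace ℝ (Fin n)) (T : ℝ) : Prop :=
  γ 0 = x ∧ IsIntegralCurveOn γ (fun _ => f) (Icc 0 T)

lemma mem_maxInterval_iff (hT : 0 ≤ T) :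
    T ∈ maxInterval f x ↔ ∃ γ, IsSolutionUpTo f x γ T := by
  simp [maxInterval, IsSolutionUpTo, uIcc_of_le hT]

lemma IsSolutionUpTo.mono (h : IsSolutionUpTo f x γ T) (ht : t ≤ T) : IsSolutionUpTo f x γ t :=
  ⟨h.1, h.2.mono (Icc_subset_Icc_right ht)⟩

lemma IsSolutionUpTo.continuousOn (h : IsSolutionUpTo f x γ T) : ContinuousOn γ (Icc 0 T) :=
  h.2.continuousOn

lemma IsSolutionUpTo.hasDerivWithinAt_Ici (h : IsSolutionUpTo f x γ T) (ht : t ∈ Ico 0 T) :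
    HasDerivWithinAt γ (f (γ t)) (Ici t) t :=
  (h.2 t (Ico_subset_Icc_self ht)).mono_of_mem_nhdsWithin
    (mem_of_superset (Icc_mem_nhdsGE ht.2) (Icc_subset_Icc_left ht.1))

lemma IsSolutionUpTo.congr_field (h : IsSolutionUpTo f x γ T)
    (hfg : ∀ t ∈ Icc 0 T, g (γ t) = f (γ t)) : IsSolutionUpTo g x γ T :=
  ⟨h.1, fun t ht => by simpa only [hfg t ht] using h.2 t ht⟩

lemma IsSolutionUpTo.congr (h : IsSolutionUpTo f x γ T) (hT : 0 ≤ T) (hη : EqOn η γ (Icc 0 T)) :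
    IsSolutionUpTo f x η T :=
  ⟨(hη (left_mem_Icc.2 hT)).trans h.1, fun t ht => by
    simpa only [hη ht] using (h.2 t ht).congr hη (hη ht)⟩

lemma IsSolutionUpTo.exists_norm_le (h : IsSolutionUpTo f x γ T) :
    ∃ R : ℝ, 0 ≤ R ∧ ∀ t ∈ Icc 0 T, ‖γ t‖ ≤ R := by
  obtain ⟨R, hR⟩ := isCompact_Icc.exists_bound_of_continuousOn h.continuousOn
  exact ⟨max R 0, le_max_right _ _, fun t ht => (hR t ht).trans (le_max_left _ _)⟩

lemma IsSolutionUpTo.dist_le {K : ℝ≥0} (hg : LipschitzWith K g) (h : IsSolutionUpTo g x γ T)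
    (h' : IsSolutionUpTo g y η T) (ht : t ∈ Icc 0 T) :
    dist (γ t) (η t) ≤ dist x y * Real.exp (K * T) := by
  have := dist_le_of_trajectories_ODE (v := fun _ => g) (fun _ => hg) h.continuousOn
    (fun t ht => h.hasDerivWithinAt_Ici ht) h'.continuousOn
    (fun t ht => h'.hasDerivWithinAt_Ici ht) (by rw [h.1, h'.1]) t ht
  refine this.trans ?_
  gcongr
  linarith [ht.2]

/-! ### Truncated fields: existence and uniqueness -/

/-- A locally Lipschitz vector field agrees on any given ball with a bounded, globally Lipschitz
vector field. -/
lemma exists_lipschitzWith_bounded_eqOn (hf : LocallyLipschitz f) {R : ℝ} (hR : 0 ≤ R) :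
    ∃ (g : EuclideanSpace ℝ (Fin n) → EuclideanSpace ℝ (Fin n)) (K L : ℝ≥0),
      LipschitzWith K g ∧ (∀ x, ‖g x‖ ≤ L) ∧ ∀ x, ‖x‖ ≤ R → g x = f x := by
  have hRR : -R ≤ R := by linarith
  -- `P` clamps each coordinate to [-R, R]. The cube `S` is compact and contains the ball, so `f ∘
  -- P` is bounded and globally Lipschitz.
  let S : Set (EuclideanSpace ℝ (Fin n)) :=
    WithLp.toLp 2 '' (univ.pi fun _ => Icc (-R) R)
  have hS : IsCompact S :=
    (isCompact_univ_pi fun _ => isCompact_Icc).image (PiLp.continuous_toLp 2 _)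
  let c : (Fin n → ℝ) → (Fin n → ℝ) := fun v i => projIcc (-R) R hRR (v i)
  let P : EuclideanSpace ℝ (Fin n) → EuclideanSpace ℝ (Fin n) :=
    fun x => WithLp.toLp 2 (c (WithLp.ofLp x))
  have hc : LipschitzWith 1 c := by
    refine LipschitzWith.of_edist_le fun v w => edist_pi_le_iff.2 fun i => ?_
    have h := (LipschitzWith.subtype_val (Icc (-R) R)).comp
      ((LipschitzWith.projIcc hRR).comp (LipschitzWith.eval (α := fun _ : Fin n => ℝ) i))
    simpa using h v w
  have hP := (PiLp.lipschitzWith_toLp 2 (fun _ : Fin n => ℝ)).comp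
    (hc.comp (PiLp.lipschitzWith_ofLp 2 (fun _ : Fin n => ℝ)))
  have hPS : ∀ x, P x ∈ S := fun x =>
    mem_image_of_mem _ fun i _ => (projIcc (-R) R hRR (x i)).2
  obtain ⟨K, hK⟩ := LocallyLipschitzOn.exists_lipschitzOnWith_of_compact hS hf.locallyLipschitzOn
  obtain ⟨L, hL⟩ := hS.exists_bound_of_continuousOn hf.continuous.continuousOn
  refine ⟨f ∘ P, _, L.toNNReal, lipschitzOnWith_univ.1
    (hK.comp (hP.lipschitzOnWith (s := univ)) fun x _ => hPS x),
    fun x => (hL _ (hPS x)).trans (Real.le_coe_toNNReal L), fun x hx => ?_⟩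
  have : P x = x := by
    ext i
    have hi : x i ∈ Icc (-R) R := abs_le.1 ((PiLp.norm_apply_le x i).trans hx)
    simp [P, c, projIcc_of_mem hRR hi]
  simp [this]

lemma exists_isSolutionUpTo_of_lipschitzWith {K L : ℝ≥0} (hg : LipschitzWith K g)
    (hL : ∀ x, ‖g x‖ ≤ L) (x : EuclideanSpace ℝ (Fin n)) (hT : 0 ≤ T) :
    ∃ γ, IsSolutionUpTo g x γ T := by
  -- Speed at most L keeps the curve within L·T of x, so this radius serves the whole interval.
  have h : IsPicardLindelof (fun _ => g) (tmin := 0) (tmax := T) ⟨0, left_mem_Icc.2 hT⟩ x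
      (L * T.toNNReal) 0 L K :=
    .of_time_independent (fun y _ => hL y) hg.lipschitzOnWith (by simp [hT])
  exact h.exists_eq_forall_mem_Icc_hasDerivWithinAt₀

lemma IsSolutionUpTo.eqOn (hf : LocallyLipschitz f) (h : IsSolutionUpTo f x γ T)
    (h' : IsSolutionUpTo f x η T) : EqOn γ η (Icc 0 T) := by
  obtain ⟨R, hR, hγ⟩ := h.exists_norm_le
  obtain ⟨R', -, hη⟩ := h'.exists_norm_le
  obtain ⟨g, K, L, hg, -, hgf⟩ :=
    exists_lipschitzWith_bounded_eqOn hf (hR.trans (le_max_left R R'))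
  intro t ht
  have := (h.congr_field fun t ht => hgf _ ((hγ t ht).trans (le_max_left _ _))).dist_le hg
    (h'.congr_field fun t ht => hgf _ ((hη t ht).trans (le_max_right _ _))) ht
  rw [dist_self, zero_mul] at this
  exact dist_le_zero.1 this

/-- `flow` chooses a separate curve for each time; uniqueness glues these choices into one solution.
-/
lemma IsSolutionUpTo.flow_eq (hf : LocallyLipschitz f) (h : IsSolutionUpTo f x γ T)
    (ht : t ∈ Icc 0 T) : flow f t x = γ t := by
  have hm : t ∈ maxInterval f x := (mem_maxInterval_iff ht.1).2 ⟨γ, h.mono ht.2⟩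
  have hs : IsSolutionUpTo f x (Classical.choose hm) t := by
    simpa [IsSolutionUpTo, uIcc_of_le ht.1] using Classical.choose_spec hm
  rw [flow, dif_pos hm]
  exact hs.eqOn hf (h.mono ht.2) (right_mem_Icc.2 ht.1)

lemma isSolutionUpTo_flow (hf : LocallyLipschitz f) (hT : 0 ≤ T) (h : T ∈ maxInterval f x) :
    IsSolutionUpTo f x (fun t => flow f t x) T := by
  obtain ⟨γ, hγ⟩ := (mem_maxInterval_iff hT).1 h
  exact hγ.congr hT fun t ht => hγ.flow_eq hf ht

lemma IsSolutionUpTo.mem_maxInterval (h : IsSolutionUpTo f x γ T) (ht : t ∈ Icc 0 T) :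
    t ∈ maxInterval f x :=
  (mem_maxInterval_iff ht.1).2 ⟨γ, h.mono ht.2⟩

lemma flow_zero (hf : LocallyLipschitz f) (x : EuclideanSpace ℝ (Fin n)) : flow f 0 x = x := by
  have h : IsSolutionUpTo f x (fun _ => x) 0 :=
    ⟨rfl, fun t ht => by
      obtain rfl : t = 0 := by simpa using ht
      rw [Icc_self]
      -- Within a single point the slope condition is vacuous.
      exact hasDerivWithinAt_iff_tendsto_slope.2 (by simp)⟩
  exact h.flow_eq hf (by simp)

/-! ### Semigroup property -/

/-- Concatenation of solutions. -/
lemma IsSolutionUpTo.concat (hs : 0 ≤ s) (hT : 0 ≤ T) (h : IsSolutionUpTo f x γ T)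
    (h' : IsSolutionUpTo f (γ T) η s) :
    IsSolutionUpTo f x (fun t => if t ≤ T then γ t else η (t - T)) (T + s) := by
  set ζ : ℝ → EuclideanSpace ℝ (Fin n) := fun t => if t ≤ T then γ t else η (t - T) with hζ
  have h₁ : EqOn ζ γ (Iic T) := fun t ht => if_pos ht
  have h₂ : EqOn ζ (fun t => η (t - T)) (Ici T) := fun t ht => by
    rcases (mem_Ici.1 ht).eq_or_lt with rfl | ht
    · simp [hζ, h'.1]
    · simp [hζ, not_le.2 ht]
  have hI : Icc 0 (T + s) = Icc 0 T ∪ Icc T (T + s) :=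
    (Icc_union_Icc_eq_Icc hT (by linarith)).symm
  have d₁ : ∀ t ∈ Icc 0 T, HasDerivWithinAt ζ (f (ζ t)) (Icc 0 T) t := fun t ht => by
    rw [h₁ ht.2]
    exact (h.2 t ht).congr (fun u hu => h₁ hu.2) (h₁ ht.2)
  have d₂ : ∀ t ∈ Icc T (T + s), HasDerivWithinAt ζ (f (ζ t)) (Icc T (T + s)) t := fun t ht => by
    rw [h₂ ht.1]
    have hd : HasDerivWithinAt (fun u => u - T) 1 (Icc T (T + s)) t :=
      (hasDerivWithinAt_id t _).sub_const T
    have := (h'.2 (t - T) ⟨by linarith [ht.1], by linarith [ht.2]⟩).scomp t hd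
      (show MapsTo (fun u => u - T) (Icc T (T + s)) (Icc 0 s) from
        fun u hu => ⟨by linarith [hu.1], by linarith [hu.2]⟩)
    rw [one_smul] at this
    exact this.congr (fun u hu => h₂ hu.1) (h₂ ht.1)
  refine ⟨(h₁ hT).trans h.1, fun t ht => ?_⟩
  rw [hI]
  rcases lt_trichotomy t T with hlt | rfl | hlt
  · refine (d₁ t ⟨ht.1, hlt.le⟩).mono_of_mem_nhdsWithin ?_
    rw [← hI]
    filter_upwards [self_mem_nhdsWithin, mem_nhdsWithin_of_mem_nhds (Iio_mem_nhds hlt)] with u hu hu'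
    exact ⟨hu.1, le_of_lt hu'⟩
  -- At the junction both one-sided derivatives equal `f (ζ T)`.
  · exact (d₁ t ⟨ht.1, le_rfl⟩).union (d₂ t ⟨le_rfl, ht.2⟩)
  · refine (d₂ t ⟨hlt.le, ht.2⟩).mono_of_mem_nhdsWithin ?_
    rw [← hI]
    filter_upwards [self_mem_nhdsWithin, mem_nhdsWithin_of_mem_nhds (Ioi_mem_nhds hlt)] with u hu hu'
    exact ⟨le_of_lt hu', hu.2⟩

lemma add_mem_maxInterval (hf : LocallyLipschitz f) (hs : 0 ≤ s) (hT : 0 ≤ T)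
    (h : T ∈ maxInterval f x) (h' : s ∈ maxInterval f (flow f T x)) :
    T + s ∈ maxInterval f x ∧ flow f (T + s) x = flow f s (flow f T x) := by
  have hc := (isSolutionUpTo_flow hf hT h).concat hs hT (isSolutionUpTo_flow hf hs h')
  refine ⟨hc.mem_maxInterval ⟨by linarith, le_rfl⟩, ?_⟩
  rw [hc.flow_eq hf ⟨by linarith, le_rfl⟩]
  rcases hs.eq_or_lt with rfl | hs
  · simp [flow_zero hf]
  · simp [hs]

lemma IsSolutionUpTo.shift (hT : 0 ≤ T) (h : IsSolutionUpTo f x γ (T + s)) :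
    IsSolutionUpTo f (γ T) (fun t => γ (t + T)) s := by
  refine ⟨by simp, fun t ht => ?_⟩
  have hd : HasDerivWithinAt (fun u => u + T) 1 (Icc 0 s) t :=
    (hasDerivWithinAt_id t _).add_const T
  have := (h.2 (t + T) ⟨by linarith [ht.1], by linarith [ht.2]⟩).scomp t hd
    (show MapsTo (fun u => u + T) (Icc 0 s) (Icc 0 (T + s)) from
      fun u hu => ⟨by linarith [hu.1], by linarith [hu.2]⟩)
  rwa [one_smul] at this

lemma ForwardComplete.mem (h : ForwardComplete f x) (hT : 0 ≤ T) : T ∈ maxInterval f x := h hT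

lemma ForwardComplete.flow (hf : LocallyLipschitz f) (h : ForwardComplete f x) (hT : 0 ≤ T) :
    ForwardComplete f (flow f T x) := fun _ hs =>
  ((isSolutionUpTo_flow hf (add_nonneg hT hs) (h.mem (add_nonneg hT hs))).shift hT).mem_maxInterval
    ⟨hs, le_rfl⟩

lemma ForwardComplete.flow_add (hf : LocallyLipschitz f) (h : ForwardComplete f x) (hT : 0 ≤ T)
    (hs : 0 ≤ s) : ZubovLyapunov.flow f (T + s) x
      = ZubovLyapunov.flow f s (ZubovLyapunov.flow f T x) :=
  (add_mem_maxInterval hf hs hT (h.mem hT) ((h.flow hf hT).mem hs)).2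

lemma forwardComplete_of_flow (hf : LocallyLipschitz f) (hT : 0 ≤ T) (h : T ∈ maxInterval f x)
    (h' : ForwardComplete f (flow f T x)) : ForwardComplete f x := fun t ht => by
  rcases le_total t T with htT | htT
  · exact (isSolutionUpTo_flow hf hT h).mem_maxInterval ⟨ht, htT⟩
  · have := (add_mem_maxInterval hf (sub_nonneg.2 htT) hT h (h'.mem (sub_nonneg.2 htT))).1
    rwa [add_sub_cancel] at this

/-! ### Continuous dependence -/

/-- Continuous dependence on the initial value, uniformly on `[0, T]`. -/
lemma eventually_dist_flow_lt (hf : LocallyLipschitz f) (hT : 0 ≤ T) (h : T ∈ maxInterval f x)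
    {ε : ℝ} (hε : 0 < ε) :
    ∀ᶠ y in 𝓝 x, T ∈ maxInterval f y ∧ ∀ t ∈ Icc 0 T, dist (flow f t x) (flow f t y) < ε := by
  have hx := isSolutionUpTo_flow hf hT h
  obtain ⟨R, hR, hxR⟩ := hx.exists_norm_le
  -- The margin 1 keeps truncated orbits within distance 1 of the reference orbit in the ball where
  -- `g = f`.
  obtain ⟨g, K, L, hg, hL, hgf⟩ := exists_lipschitzWith_bounded_eqOn hf (add_nonneg hR zero_le_one)
  have hx' : IsSolutionUpTo g x (fun t => flow f t x) T :=
    hx.congr_field fun t ht => hgf _ ((hxR t ht).trans (by linarith))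
  have hlim : Tendsto (fun y => dist x y * Real.exp (K * T)) (𝓝 x) (𝓝 0) := by
    have : Continuous fun y => dist x y * Real.exp (K * T) := by fun_prop
    simpa using this.tendsto x
  filter_upwards [hlim.eventually (gt_mem_nhds (lt_min hε one_pos))] with y hy
  obtain ⟨γ, hγ⟩ := exists_isSolutionUpTo_of_lipschitzWith hg hL y hT
  have hd : ∀ t ∈ Icc 0 T, dist (flow f t x) (γ t) < min ε 1 := fun t ht =>
    (hx'.dist_le hg hγ ht).trans_lt hy
  have hγf : IsSolutionUpTo f y γ T := hγ.congr_field fun t ht => by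
    refine (hgf _ ?_).symm
    have h₁ := (hd t ht).trans_le (min_le_right _ _)
    have h₂ := hxR t ht
    rw [dist_comm, dist_eq_norm] at h₁
    have h₃ := norm_le_norm_add_norm_sub' (γ t) (flow f t x)
    linarith
  refine ⟨hγf.mem_maxInterval ⟨hT, le_rfl⟩, fun t ht => ?_⟩
  rw [hγf.flow_eq hf ht]
  exact (hd t ht).trans_le (min_le_left _ _)

lemma continuousAt_flow (hf : LocallyLipschitz f) (hT : 0 ≤ T) (h : T ∈ maxInterval f x) :
    ContinuousAt (flow f T) x := Metric.continuousAt_iff'.2 fun ε hε => by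
  filter_upwards [eventually_dist_flow_lt hf hT h hε] with y hy
  rw [dist_comm]
  exact hy.2 T ⟨hT, le_rfl⟩

/-- Solutions starting in the closure of a bounded forward invariant set of forward complete
points exist for all `t ≥ 0`. -/
lemma forwardComplete_of_mem_closure (hf : LocallyLipschitz f)
    {D : Set (EuclideanSpace ℝ (Fin n))} (hD : Bornology.IsBounded D)
    (hinv : ∀ x ∈ D, ForwardComplete f x ∧ ∀ t, 0 ≤ t → flow f t x ∈ D) (hy : y ∈ closure D) :
    ForwardComplete f y := by
  intro T hT
  obtain ⟨R, hR⟩ := hD.exists_norm_le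
  obtain ⟨x₀, hx₀⟩ := closure_nonempty_iff.1 ⟨y, hy⟩
  have hR0 : 0 ≤ R := (norm_nonneg _).trans (hR x₀ hx₀)
  obtain ⟨g, K, L, hg, hL, hgf⟩ := exists_lipschitzWith_bounded_eqOn hf hR0
  obtain ⟨γ, hγ⟩ := exists_isSolutionUpTo_of_lipschitzWith hg hL y hT
  refine IsSolutionUpTo.mem_maxInterval (γ := γ) (hγ.congr_field fun t ht => (hgf _ ?_).symm)
    ⟨hT, le_rfl⟩
  -- Orbits from `z ∈ D` have norm at most R, so Grönwall bounds `‖γ t‖` by R plus an error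
  -- vanishing as z → y.
  have hlim : Tendsto (fun z => R + dist y z * Real.exp (K * T)) (𝓝[D] y) (𝓝 R) := by
    have : Continuous fun z => R + dist y z * Real.exp (K * T) := by fun_prop
    simpa using (this.tendsto y).mono_left nhdsWithin_le_nhds
  have := mem_closure_iff_nhdsWithin_neBot.1 hy
  refine ge_of_tendsto hlim ?_
  filter_upwards [self_mem_nhdsWithin] with z hz
  have hz' : IsSolutionUpTo g z (fun t => flow f t z) T :=
    (isSolutionUpTo_flow hf hT ((hinv z hz).1.mem hT)).congr_field
      fun t ht => hgf _ (hR _ ((hinv z hz).2 t ht.1))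
  have h₁ := hγ.dist_le hg hz' ht
  have h₂ := hR _ ((hinv z hz).2 t ht.1)
  rw [dist_eq_norm] at h₁
  have h₃ := norm_le_norm_add_norm_sub' (γ t) (flow f t z)
  linarith

/-! ### Head and tail of V -/

/-- The part `∫₀^T ω(φ(t,x)) dt` of `V` that is accumulated up to time `T`. -/
def partialV (f : EuclideanSpace ℝ (Fin n) → EuclideanSpace ℝ (Fin n))
    (ω : EuclideanSpace ℝ (Fin n) → ℝ) (T : ℝ) (x : EuclideanSpace ℝ (Fin n)) : ℝ≥0∞ :=
  ∫⁻ t in Ico 0 T, ENNReal.ofReal (ω (flow f t x))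

lemma V_eq (h : ForwardComplete f x) :
    V f ω x = ∫⁻ t in Ici (0 : ℝ), ENNReal.ofReal (ω (flow f t x)) := if_pos h

lemma forwardComplete_of_V_lt_top (h : V f ω x < ⊤) : ForwardComplete f x := by
  by_contra hx
  simp [V, hx] at h

lemma V_split (hf : LocallyLipschitz f) (hT : 0 ≤ T) (h : ForwardComplete f x) :
    V f ω x = partialV f ω T x + V f ω (flow f T x) := by
  have hshift : ∫⁻ t in Ici T, ENNReal.ofReal (ω (flow f t x)) = V f ω (flow f T x) := by
    rw [V_eq (h.flow hf hT), ← (measurePreserving_add_left volume T).setLIntegral_comp_preimage_emb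
      (measurableEmbedding_addLeft T)]
    rw [preimage_const_add_Ici, sub_self]
    refine setLIntegral_congr_fun measurableSet_Ici fun s hs => ?_
    simp only [h.flow_add hf hT hs]
  rw [V_eq h, partialV, ← hshift, ← Ico_union_Ici_eq_Ici hT]
  exact lintegral_union measurableSet_Ici (Set.disjoint_left.2 fun t ht ht' => not_le.2 ht.2 ht')

lemma partialV_le_V : partialV f ω T x ≤ V f ω x := by
  by_cases h : ForwardComplete f x
  · rw [V_eq h]
    exact lintegral_mono_set Ico_subset_Ici_self
  · simp [V, h]

lemma exists_lt_partialV (h : ForwardComplete f x) {M : ℝ≥0∞} (hM : M < V f ω x) :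
    ∃ T : ℝ, 0 ≤ T ∧ M < partialV f ω T x := by
  have hU : Ici (0 : ℝ) = ⋃ k : ℕ, Ico (0 : ℝ) k := by
    ext t
    simpa using fun _ => exists_nat_gt t
  have hmono : Monotone fun k : ℕ => Ico (0 : ℝ) k := fun i j hij =>
    Ico_subset_Ico_right (by exact_mod_cast hij)
  rw [V_eq h, hU, setLIntegral_iUnion_of_directed _ hmono.directed_le, lt_iSup_iff] at hM
  obtain ⟨k, hk⟩ := hM
  exact ⟨k, k.cast_nonneg, hk⟩

lemma continuousOn_comp_flow (hf : LocallyLipschitz f) (hω : Continuous ω) (hT : 0 ≤ T)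
    (h : T ∈ maxInterval f x) : ContinuousOn (fun t => ω (flow f t x)) (Icc 0 T) :=
  hω.comp_continuousOn (isSolutionUpTo_flow hf hT h).continuousOn

lemma partialV_lt_top (hf : LocallyLipschitz f) (hω : Continuous ω) (hT : 0 ≤ T)
    (h : T ∈ maxInterval f x) : partialV f ω T x < ⊤ :=
  ((continuousOn_comp_flow hf hω hT h).integrableOn_Icc.mono_set
    Ico_subset_Icc_self).lintegral_lt_top

lemma partialV_le_add {c : ℝ} (hc : 0 ≤ c)
    (h : ∀ t ∈ Icc 0 T, ω (flow f t y) ≤ ω (flow f t x) + c) :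
    partialV f ω T y ≤ partialV f ω T x + ENNReal.ofReal (c * T) := by
  calc partialV f ω T y
      ≤ ∫⁻ t in Ico 0 T, (ENNReal.ofReal (ω (flow f t x)) + ENNReal.ofReal c) :=
        setLIntegral_mono' measurableSet_Ico fun t ht =>
          (ENNReal.ofReal_le_ofReal (h t (Ico_subset_Icc_self ht))).trans ENNReal.ofReal_add_le
    _ = partialV f ω T x + ENNReal.ofReal (c * T) := by
        rw [lintegral_add_right _ measurable_const, setLIntegral_const, Real.volume_Ico, sub_zero,
          ENNReal.ofReal_mul hc, partialV]

lemma eventually_partialV_close (hf : LocallyLipschitz f) (hω : Continuous ω) (hT : 0 ≤ T)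
    (h : T ∈ maxInterval f x) {ε : ℝ} (hε : 0 < ε) :
    ∀ᶠ y in 𝓝 x, partialV f ω T y ≤ partialV f ω T x + ENNReal.ofReal ε ∧
      partialV f ω T x ≤ partialV f ω T y + ENNReal.ofReal ε := by
  -- Dividing by T + 1 covers T = 0.
  have hc : 0 < ε / (T + 1) := by positivity
  have hcT : ε / (T + 1) * T ≤ ε := by
    rw [div_mul_eq_mul_div, div_le_iff₀ (by linarith)]
    nlinarith
  have hK : IsCompact ((fun t => flow f t x) '' Icc 0 T) :=
    isCompact_Icc.image_of_continuousOn (isSolutionUpTo_flow hf hT h).continuousOn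
  -- Only one of the two points has to lie on the compact orbit segment; the other is arbitrary.
  obtain ⟨δ, hδ, hδω⟩ := Metric.mem_uniformity_dist.1
    (hK.uniformContinuousAt_of_continuousAt ω (fun a _ => hω.continuousAt)
      (Metric.dist_mem_uniformity hc))
  filter_upwards [eventually_dist_flow_lt hf hT h hδ] with y hy
  have key : ∀ t ∈ Icc 0 T, |ω (flow f t x) - ω (flow f t y)| < ε / (T + 1) := fun t ht =>
    hδω (hy.2 t ht) (mem_image_of_mem _ ht)
  have hle := ENNReal.ofReal_le_ofReal hcT
  refine ⟨(partialV_le_add (x := x) hc.le fun t ht => ?_).trans (by gcongr),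
    (partialV_le_add (x := y) hc.le fun t ht => ?_).trans (by gcongr)⟩
  · linarith [(abs_lt.1 (key t ht)).1]
  · linarith [(abs_lt.1 (key t ht)).2]

/-- `V` is lower semicontinuous at every point whose solution exists for all `t ≥ 0`. -/
lemma eventually_lt_V (hf : LocallyLipschitz f) (hω : Continuous ω) (h : ForwardComplete f x)
    {M : ℝ≥0∞} (hM : M < V f ω x) : ∀ᶠ y in 𝓝 x, M < V f ω y := by
  obtain ⟨T, hT, hMT⟩ := exists_lt_partialV h hM
  obtain ⟨r, hr, hMr⟩ := ENNReal.lt_iff_exists_add_pos_lt.1 hMT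
  filter_upwards [eventually_partialV_close hf hω hT (h.mem hT) (NNReal.coe_pos.2 hr)] with y hy
  rw [ENNReal.ofReal_coe_nnreal] at hy
  exact (lt_of_add_lt_add_right (hMr.trans_le hy.2)).trans_le partialV_le_V

lemma V_lt_top_of_flow (hf : LocallyLipschitz f) (hω : Continuous ω) (hT : 0 ≤ T)
    (h : T ∈ maxInterval f x) (hV : V f ω (flow f T x) < ⊤) : V f ω x < ⊤ := by
  rw [V_split hf hT (forwardComplete_of_flow hf hT h (forwardComplete_of_V_lt_top hV))]
  exact ENNReal.add_lt_top.2 ⟨partialV_lt_top hf hω hT h, hV⟩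

/-! ### Domain of attraction and its boundary -/

lemma exists_infDist_flow_lt (hx : x ∈ domainOfAttraction f A) {ε : ℝ} (hε : 0 < ε) :
    ∃ T : ℝ, 0 ≤ T ∧ Metric.infDist (flow f T x) A < ε := by
  obtain ⟨T, hT, h0⟩ := ((hx.2.eventually (gt_mem_nhds hε)).and (eventually_ge_atTop 0)).exists
  exact ⟨T, h0, hT⟩

lemma eventually_infDist_flow_lt (hf : LocallyLipschitz f) (hT : 0 ≤ T) (h : T ∈ maxInterval f x)
    {ε : ℝ} (hε : Metric.infDist (flow f T x) A < ε) :
    ∀ᶠ y in 𝓝 x, Metric.infDist (flow f T y) A < ε :=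
  ((Metric.continuous_infDist_pt A).continuousAt.comp (continuousAt_flow hf hT h)).eventually
    (gt_mem_nhds hε)

lemma mem_domainOfAttraction_of_V_lt_top (hf : LocallyLipschitz f) (hUAS : IsUAS f A)
    (hωV : OmegaAssumption f ω A) (hV : V f ω x < ⊤) : x ∈ domainOfAttraction f A := by
  have hx := forwardComplete_of_V_lt_top hV
  refine ⟨hx, Metric.tendsto_atTop.2 fun ε hε => ?_⟩
  obtain ⟨δ, hδ, hstab⟩ := hUAS.stable ε hε
  obtain ⟨c, hc, hωc⟩ := hωV.lower (δ / 2) (half_pos hδ)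
  -- Otherwise ω > c along the whole orbit and the integral diverges.
  obtain ⟨T, hT, hTδ⟩ : ∃ T : ℝ, 0 ≤ T ∧ Metric.infDist (flow f T x) A ≤ δ / 2 := by
    by_contra! hfar
    refine hV.not_ge ?_
    rw [V_eq hx]
    calc ⊤ = ∫⁻ _ in Ici (0 : ℝ), ENNReal.ofReal c := by
          rw [setLIntegral_const, Real.volume_Ici, ENNReal.mul_top (by simpa using hc)]
      _ ≤ _ := setLIntegral_mono' measurableSet_Ici fun t ht =>
          ENNReal.ofReal_le_ofReal (hωc _ (hfar t ht)).le
  refine ⟨T, fun t ht => ?_⟩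
  have := (hstab _ (hTδ.trans_lt (half_lt_self hδ))).2 (t - T) (sub_nonneg.2 ht)
  rw [← hx.flow_add hf hT (sub_nonneg.2 ht), add_sub_cancel] at this
  rwa [Real.dist_eq, sub_zero, abs_of_nonneg Metric.infDist_nonneg]

lemma V_lt_top_iff (hf : LocallyLipschitz f) (hω : Continuous ω) (hUAS : IsUAS f A)
    (hωV : OmegaAssumption f ω A) : V f ω x < ⊤ ↔ x ∈ domainOfAttraction f A := by
  refine ⟨mem_domainOfAttraction_of_V_lt_top hf hUAS hωV, fun hx => ?_⟩
  obtain ⟨ρ, hρ, hfin⟩ := hωV.finite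
  obtain ⟨T, hT, hTρ⟩ := exists_infDist_flow_lt hx hρ
  exact V_lt_top_of_flow hf hω hT (hx.1.mem hT) (hfin _ hTρ)

lemma isOpen_domainOfAttraction (hf : LocallyLipschitz f) (hω : Continuous ω) (hUAS : IsUAS f A)
    (hωV : OmegaAssumption f ω A) : IsOpen (domainOfAttraction f A) := by
  refine isOpen_iff_mem_nhds.2 fun x hx => ?_
  obtain ⟨ρ, hρ, hfin⟩ := hωV.finite
  obtain ⟨T, hT, hTρ⟩ := exists_infDist_flow_lt hx hρ
  filter_upwards [eventually_dist_flow_lt hf hT (hx.1.mem hT) one_pos,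
    eventually_infDist_flow_lt hf hT (hx.1.mem hT) hTρ] with y hy hyρ
  exact (V_lt_top_iff hf hω hUAS hωV).1 (V_lt_top_of_flow hf hω hT hy.1 (hfin _ hyρ))

lemma flow_mem_domainOfAttraction (hf : LocallyLipschitz f) (hx : x ∈ domainOfAttraction f A)
    (hT : 0 ≤ T) : flow f T x ∈ domainOfAttraction f A := by
  refine ⟨hx.1.flow hf hT, (hx.2.comp (tendsto_atTop_add_const_left atTop T tendsto_id)).congr' ?_⟩
  filter_upwards [eventually_ge_atTop 0] with t ht
  simp [hx.1.flow_add hf hT ht]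

lemma tendsto_V_frontier (hf : LocallyLipschitz f) (hω : Continuous ω) (hUAS : IsUAS f A)
    (hωV : OmegaAssumption f ω A) (hy : y ∈ frontier (domainOfAttraction f A))
    (h : Bornology.IsBounded (domainOfAttraction f A) ∨ ForwardComplete f y) :
    Tendsto (V f ω) (𝓝 y) (𝓝 ⊤) := by
  have hfc : ForwardComplete f y := h.elim (fun hb => forwardComplete_of_mem_closure hf hb
    (fun x hx => ⟨hx.1, fun t ht => flow_mem_domainOfAttraction hf hx ht⟩)
    (frontier_subset_closure hy)) id
  rw [(isOpen_domainOfAttraction hf hω hUAS hωV).frontier_eq] at hy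
  have hV : V f ω y = ⊤ := not_lt_top_iff.1 fun hlt => hy.2 ((V_lt_top_iff hf hω hUAS hωV).1 hlt)
  exact tendsto_order.2 ⟨fun M hM => eventually_lt_V hf hω hfc (hV ▸ hM),
    fun M hM => absurd hM not_top_lt⟩

/-! ### Positivity, continuity and derivative of V -/

lemma V_pos (hf : LocallyLipschitz f) (hω : Continuous ω) (hx : 0 < ω x) : 0 < V f ω x := by
  by_cases h : ForwardComplete f x
  · have hcont := continuousOn_comp_flow hf hω zero_le_one (h.mem zero_le_one)
    have hpos : ∀ᶠ t in 𝓝[≥] (0 : ℝ), ω x / 2 < ω (flow f t x) := by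
      have h0 := hcont 0 (by simp)
      rw [continuousWithinAt_Icc_iff_Ici one_pos] at h0
      refine h0.eventually (lt_mem_nhds ?_)
      simpa only [flow_zero hf] using half_lt_self hx
    obtain ⟨δ, hδ, hsub⟩ := mem_nhdsGE_iff_exists_Ico_subset.1 hpos
    refine lt_of_lt_of_le ?_ (partialV_le_V (T := δ))
    calc 0 < ENNReal.ofReal (ω x / 2) * ENNReal.ofReal δ :=
          ENNReal.mul_pos (by simpa using hx) (by simpa using hδ)
      _ = ∫⁻ _ in Ico 0 δ, ENNReal.ofReal (ω x / 2) := by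
          rw [setLIntegral_const, Real.volume_Ico, sub_zero]
      _ ≤ _ := setLIntegral_mono' measurableSet_Ico fun t ht =>
          ENNReal.ofReal_le_ofReal (le_of_lt (hsub ht))
  · simp [V, h]

lemma isPosDefOn_V (hf : LocallyLipschitz f) (hω : Continuous ω) (hω_pos : IsPosDefOn ω univ A)
    (hωV : OmegaAssumption f ω A) : IsPosDefOn (V f ω) univ A := by
  refine ⟨fun x hx => ?_, fun x hx => V_pos hf hω (hω_pos.2 x hx)⟩
  by_contra hne
  obtain ⟨r, hr, hrV⟩ := ENNReal.lt_iff_exists_nnreal_btwn.1 (pos_iff_ne_zero.2 hne)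
  obtain ⟨δ, hδ, hsmall⟩ := hωV.small r (by exact_mod_cast hr)
  have := hsmall x (by rwa [Metric.infDist_zero_of_mem hx])
  rw [ENNReal.ofReal_coe_nnreal] at this
  exact lt_asymm this hrV

/-- The time T is chosen for x alone, yet orbits from nearby y also lie δ-close to `A` at time T.
Head and tail each cost r/2. -/
lemma continuousAt_V (hf : LocallyLipschitz f) (hω : Continuous ω)
    (hωV : OmegaAssumption f ω A) (hx : x ∈ domainOfAttraction f A) : ContinuousAt (V f ω) x := by
  refine tendsto_order.2 ⟨fun M hM => eventually_lt_V hf hω hx.1 hM, fun M hM => ?_⟩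
  obtain ⟨r, hr, hrM⟩ := ENNReal.lt_iff_exists_add_pos_lt.1 hM
  have hr2 : (0 : ℝ) < r / 2 := half_pos (NNReal.coe_pos.2 hr)
  obtain ⟨δ, hδ, hsmall⟩ := hωV.small (r / 2) hr2
  obtain ⟨T, hT, hTδ⟩ := exists_infDist_flow_lt hx hδ
  have hm := hx.1.mem hT
  filter_upwards [eventually_dist_flow_lt hf hT hm one_pos, eventually_infDist_flow_lt hf hT hm hTδ,
    eventually_partialV_close hf hω hT hm hr2] with y hy hyδ hyV
  have hVT := hsmall _ hyδ
  have hfc := forwardComplete_of_flow hf hT hy.1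
    (forwardComplete_of_V_lt_top (hVT.trans ENNReal.ofReal_lt_top))
  calc V f ω y = partialV f ω T y + V f ω (flow f T y) := V_split hf hT hfc
    _ ≤ partialV f ω T x + ENNReal.ofReal (r / 2) + ENNReal.ofReal (r / 2) :=
        add_le_add hyV.1 hVT.le
    _ ≤ V f ω x + r := by
        rw [add_assoc, ← ENNReal.ofReal_add hr2.le hr2.le, add_halves, ENNReal.ofReal_coe_nnreal]
        gcongr
        exact partialV_le_V
    _ < M := hrM

lemma toReal_partialV (hf : LocallyLipschitz f) (hω : Continuous ω) (hω0 : ∀ x, 0 ≤ ω x)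
    (hT : 0 ≤ T) (h : T ∈ maxInterval f x) :
    (partialV f ω T x).toReal = ∫ t in (0 : ℝ)..T, ω (flow f t x) := by
  have hint : IntegrableOn (fun t => ω (flow f t x)) (Ico 0 T) volume :=
    (continuousOn_comp_flow hf hω hT h).integrableOn_Icc.mono_set (Ico_subset_Icc_self : Ico (0 : ℝ) T ⊆ Icc 0 T)
  rw [intervalIntegral.integral_of_le hT, integral_Ioc_eq_integral_Ioo,
    ← integral_Ico_eq_integral_Ioo, integral_eq_lintegral_of_nonneg_ae (Eventually.of_forall fun t => hω0 _) hint.1, partialV]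

lemma hasDerivAlong_V (hf : LocallyLipschitz f) (hω : Continuous ω) (hω0 : ∀ x, 0 ≤ ω x)
    (hV : V f ω x < ⊤) : HasDerivAlong f (V f ω) x (-ω x) := by
  have hx := forwardComplete_of_V_lt_top hV
  have hVt : ∀ t, 0 ≤ t → V f ω (flow f t x) < ⊤ := fun t ht =>
    lt_of_le_of_lt (by rw [V_split hf ht hx]; exact le_add_self) hV
  refine ⟨hV, eventually_mem_nhdsWithin.mono fun t ht =>
    ⟨hx.mem (le_of_lt ht), hVt t (le_of_lt ht)⟩, ?_⟩
  -- Extending by constants outside [0, 1] gives a globally continuous integrand, so the two-sided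
  -- fundamental theorem applies at 0.
  set F : ℝ → ℝ := IccExtend zero_le_one ((Icc (0 : ℝ) 1).domRestrict fun t => ω (flow f t x)) with hF
  have hFc : Continuous F := (continuousOn_iff_continuous_domRestrict.1
    (continuousOn_comp_flow hf hω zero_le_one (hx.mem zero_le_one))).Icc_extend'
  have hF_eq : ∀ t ∈ Icc (0 : ℝ) 1, F t = ω (flow f t x) := fun t ht => by
    rw [hF, IccExtend_of_mem _ _ ht]
    rfl
  have hd := hFc.integral_hasStrictDerivAt 0 0 |>.hasDerivAt.hasDerivWithinAt (s := Ioi 0)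
  rw [hF_eq 0 (by simp), flow_zero hf, hasDerivWithinAt_iff_tendsto_slope' (by simp)] at hd
  refine hd.neg.congr' ?_
  filter_upwards [Ioo_mem_nhdsGT (zero_lt_one (α := ℝ))] with t ht
  have hsplit : (V f ω x).toReal = (∫ s in (0 : ℝ)..t, F s) + (V f ω (flow f t x)).toReal := by
    rw [V_split hf ht.1.le hx, ENNReal.toReal_add
      (partialV_lt_top hf hω ht.1.le (hx.mem ht.1.le)).ne (hVt t ht.1.le).ne,
      toReal_partialV hf hω hω0 ht.1.le (hx.mem ht.1.le)]
    congr 1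
    refine intervalIntegral.integral_congr fun s hs => (hF_eq s ?_).symm
    rw [uIcc_of_le ht.1.le] at hs
    exact ⟨hs.1, hs.2.trans ht.2.le⟩
  rw [slope_def_field, intervalIntegral.integral_same, hsplit]
  ring

end ZubovLyapunov

end

theorem proposition1 (n : ℕ)
    (f : EuclideanSpace ℝ (Fin n) → EuclideanSpace ℝ (Fin n)) (hf : LocallyLipschitz f)
    (A : Set (EuclideanSpace ℝ (Fin n))) (hA : IsCompact A) (hA_ne : A.Nonempty)
    (hUAS : ZubovLyapunov.IsUAS f A)
    (ω : EuclideanSpace ℝ (Fin n) → ℝ) (hω : Continuous ω)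
    (hω_pos : ZubovLyapunov.IsPosDefOn ω univ A)
    (hωV : ZubovLyapunov.OmegaAssumption f ω A) :
    (∀ x, ZubovLyapunov.V f ω x < ⊤ ↔ x ∈ ZubovLyapunov.domainOfAttraction f A) ∧
    (∀ y ∈ frontier (ZubovLyapunov.domainOfAttraction f A),
      (Bornology.IsBounded (ZubovLyapunov.domainOfAttraction f A) ∨
        ZubovLyapunov.ForwardComplete f y) →
      Tendsto (ZubovLyapunov.V f ω) (𝓝 y) (𝓝 ⊤)) ∧
    ZubovLyapunov.IsPosDefOn (ZubovLyapunov.V f ω) univ A ∧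
    ContinuousOn (ZubovLyapunov.V f ω) (ZubovLyapunov.domainOfAttraction f A) ∧
    (∀ x ∈ ZubovLyapunov.domainOfAttraction f A,
      ZubovLyapunov.HasDerivAlong f (ZubovLyapunov.V f ω) x (-ω x)) := by
  have hω0 : ∀ x, 0 ≤ ω x := fun x => by
    by_cases hx : x ∈ A
    · exact (hω_pos.1 x hx).ge
    · exact (hω_pos.2 x ⟨mem_univ x, hx⟩).le
  exact ⟨fun x => ZubovLyapunov.V_lt_top_iff hf hω hUAS hωV,
    fun y hy h => ZubovLyapunov.tendsto_V_frontier hf hω hUAS hωV hy h,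
    ZubovLyapunov.isPosDefOn_V hf hω hω_pos hωV,
    fun x hx => (ZubovLyapunov.continuousAt_V hf hω hωV hx).continuousWithinAt,
    fun x hx => ZubovLyapunov.hasDerivAlong_V hf hω hω0
      ((ZubovLyapunov.V_lt_top_iff hf hω hUAS hωV).2 hx)⟩
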